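/- Let $G$ be a topological Abelian group and let $E$ be a Banach space over $\mathbb C$. For $f\colon G\to E$ let $L_f$ be the linear span over $\mathbb C$ of the translates $x\mapsto f(x+g)$ $(g\in G)$. We use the following definitions. - A complex valued polynomial on $G$ is a function $P(a_1,\ldots,a_n)$, where $a_1,\ldots,a_n\colon G\to\mathbb C$ are continuous additive functions and $P\in\mathbb C[x_1,\ldots,x_n]$. An exponential on $G$ is a continuous function $m\colon G\to\mathbb C$, not identically zero, with $m(x+y)=m(x)m(y)$ for all $x,y\in G$. A complex valued exponential polynomial is a finite sum $\sum_{i=1}^n p_i m_i$, where the $p_i$ are complex valued polynomials and the $m_i$ are exponentials. - A function $f\colon G\to E$ is an exponential polynomial if $f$ is continuous and $\dim L_f<\infty$. - A function $f\colon G\to E$ is a w-exponential polynomial if $f$ is continuous and $u\circ f$ is a complex valued exponential polynomial for every continuous linear functional $u\in E^*$. - The torsion free rank $r_0(H)$ of an Abelian group $H$ is the cardinality of a maximal independent system of elements of infinite order of $H$. Suppose that $G$ has a dense subgroup $H$ with $r_0(H)<\infty$. Then a function $f\colon G\to E$ is a w-exponential polynomial if and only if $f$ is an exponential polynomial. In particular,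 if $G=\mathbb R^p$ with the Euclidean topology, then a function $f\colon G\to E$ is a w-exponential polynomial if and only if $f$ is an exponential polynomial. -/

import Mathlib

namespace VectorPoly

section Defs

variable {G : Type*} [AddCommMonoid G] {E : Type*} [AddCommGroup E] [Module ℂ E]

/-- The translate `T_g f`, given by `T_g f (x) = f (x + g)`. -/
def translation (g : G) (f : G → E) : G → E := fun x => f (x + g)

/-- `L_f`: the linear span over `ℂ` of all translates of `f`. -/
def translateSpan (f : G → E) : Submodule ℂ (G → E) :=
  Submodule.span ℂ (Set.range fun g : G => translation g f)

end Defs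

/-- A complex valued polynomial on `G`: a function of the form `P(a₁, …, aₙ)`, where `a₁, …, aₙ`
are continuous additive functions `G → ℂ` and `P ∈ ℂ[x₁, …, xₙ]`. -/
def IsComplexPolynomial {G : Type*} [AddCommMonoid G] [TopologicalSpace G] (f : G → ℂ) : Prop :=
  ∃ (n : ℕ) (a : Fin n → (G →+ ℂ)) (P : MvPolynomial (Fin n) ℂ),
    (∀ i, Continuous (a i)) ∧ ∀ x, f x = MvPolynomial.eval (fun i => a i x) P

/-- An exponential function: continuous, not identically zero, and multiplicative. -/
def IsExponential {G : Type*} [AddCommMonoid G] [TopologicalSpace G] (m : G → ℂ) : Prop :=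
  Continuous m ∧ m ≠ 0 ∧ ∀ x y, m (x + y) = m x * m y

/-- A complex valued exponential polynomial: a finite sum `p₁ m₁ + … + pₙ mₙ`, where the `pᵢ` are
complex valued polynomials and the `mᵢ` are exponentials. -/
def IsComplexExpPolynomial {G : Type*} [AddCommMonoid G] [TopologicalSpace G]
    (f : G → ℂ) : Prop :=
  ∃ (n : ℕ) (p m : Fin n → G → ℂ),
    (∀ i, IsComplexPolynomial (p i)) ∧ (∀ i, IsExponential (m i)) ∧
      ∀ x, f x = ∑ i, p i x * m i x

/-- An `E`-valued exponential polynomial: a continuous function whose translates span a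
finite dimensional space. -/
def IsExpPolynomial {G : Type*} [AddCommMonoid G] [TopologicalSpace G]
    {E : Type*} [NormedAddCommGroup E] [NormedSpace ℂ E] (f : G → E) : Prop :=
  Continuous f ∧ FiniteDimensional ℂ (translateSpan f)

/-- An `E`-valued w-exponential polynomial: a continuous function `f` such that `u ∘ f` is a complex
valued exponential polynomial for every continuous linear functional `u` on `E`. -/
def IsWExpPolynomial {G : Type*} [AddCommMonoid G] [TopologicalSpace G]
    {E : Type*} [NormedAddCommGroup E] [NormedSpace ℂ E] (f : G → E) : Prop :=
  Continuous f ∧ ∀ u : StrongDual ℂ E, IsComplexExpPolynomial fun x => u (f x)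

/-- The torsion free rank `r₀(A)` of an Abelian group: the common cardinality of its maximal
systems of independent elements of infinite order, that is, of its maximal `ℤ`-linearly
independent subsets. -/
noncomputable def torsionFreeRank (A : Type*) [AddCommGroup A] : Cardinal := Module.rank ℤ A

end VectorPoly

/-! A continuous scalar function is an exponential polynomial exactly when its translates span a
finite dimensional space. One half is closure of this finiteness under sums and products. For the
other, `isComplexExpPolynomial_of_finiteDimensional`, the commuting translations split the span into
joint generalized eigenspaces. Each eigenvalue function that occurs is an exponential, and dividing
by it leaves a unipotent action. The logarithm of that action is additive, and the function is a
polynomial in its matrix entries. Applied to `u ∘ f`, this shows that exponential polynomials are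
w-exponential polynomials.

The converse is proved first on `H`, with no topology there. The dual of `E` is complete, so Baire's
theorem bounds the dimensions of the spans of all `u ∘ f` by one `N`
(`exists_finrank_translateSpan_comp_le`). Only finitely many eigenvalue functions `χ` can then
occur: given `N + 1` of them, a single `u` would see them all. Each `χ`-part is killed by every
`(T_g - χ(g)) ^ N`, and finite torsion free rank makes the space of such functions finite
dimensional (`finiteDimensional_genEigenfunctions`), because after untwisting they are polynomial
along every cyclic direction and finitely many values determine them. So all `u ∘ f` lie in one
finite dimensional invariant space, and an interpolation formula transfers this to `f`. Density and
continuity pass from `H` to `G`. -/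

namespace VectorPoly

open Module

/-! ### Translations and finite dimensional translate spans -/

section Shift

variable {G : Type*} [AddCommMonoid G] {E : Type*} [AddCommGroup E] [Module ℂ E]

/-- Translation by `g` as a linear endomorphism of the space of functions. -/
def shift (E : Type*) [AddCommGroup E] [Module ℂ E] (g : G) : Module.End ℂ (G → E) :=
  LinearMap.funLeft ℂ E fun x => x + g

@[simp] lemma shift_apply (g : G) (f : G → E) (x : G) : shift E g f x = f (x + g) := rfl

lemma shift_mul (g h : G) : shift E g * shift E h = shift E (g + h) := by
  ext f x
  simp [add_assoc]

lemma shift_zero : shift E (0 : G) = 1 := by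
  ext f x
  simp

lemma shift_commute (g h : G) : Commute (shift E g) (shift E h) := by
  rw [Commute, SemiconjBy, shift_mul, shift_mul, add_comm]

lemma shift_pow (g : G) (n : ℕ) : shift E g ^ n = shift E (n • g) := by
  induction n with
  | zero => simp [shift_zero]
  | succ n ih => rw [pow_succ, ih, shift_mul, succ_nsmul]

lemma shift_mem_translateSpan (f : G → E) (g : G) : shift E g f ∈ translateSpan f :=
  Submodule.subset_span ⟨g, rfl⟩

lemma self_mem_translateSpan (f : G → E) : f ∈ translateSpan f := by
  simpa [shift_zero] using shift_mem_translateSpan f 0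

lemma translateSpan_le {f : G → E} {W : Submodule ℂ (G → E)} (h : ∀ g, shift E g f ∈ W) :
    translateSpan f ≤ W :=
  Submodule.span_le.2 (by rintro _ ⟨g, rfl⟩; exact h g)

lemma shift_mapsTo_translateSpan (f : G → E) (g : G) {w : G → E} (hw : w ∈ translateSpan f) :
    shift E g w ∈ translateSpan f := by
  suffices translateSpan f ≤ (translateSpan f).comap (shift E g) from this hw
  refine translateSpan_le fun h => ?_
  rw [Submodule.mem_comap, ← Module.End.mul_apply, shift_mul]
  exact shift_mem_translateSpan f _

lemma finiteDimensional_translateSpan_of_mem {f : G → E} (W : Submodule ℂ (G → E))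
    [FiniteDimensional ℂ W] (h : ∀ g, shift E g f ∈ W) : FiniteDimensional ℂ (translateSpan f) :=
  Submodule.finiteDimensional_of_le (translateSpan_le h)

lemma finiteDimensional_translateSpan_comp_linearMap {F : Type*} [AddCommGroup F] [Module ℂ F]
    (u : E →ₗ[ℂ] F) {f : G → E} [FiniteDimensional ℂ (translateSpan f)] :
    FiniteDimensional ℂ (translateSpan fun x => u (f x)) :=
  finiteDimensional_translateSpan_of_mem ((translateSpan f).map (u.compLeft G))
    fun g => ⟨shift E g f, shift_mem_translateSpan f g, rfl⟩

lemma finiteDimensional_translateSpan_comp_addMonoidHom {H : Type*} [AddCommMonoid H]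
    (j : H →+ G) {f : G → E} [FiniteDimensional ℂ (translateSpan f)] :
    FiniteDimensional ℂ (translateSpan fun x => f (j x)) :=
  finiteDimensional_translateSpan_of_mem ((translateSpan f).map (LinearMap.funLeft ℂ E j))
    fun g => ⟨shift E (j g) f, shift_mem_translateSpan f _, by ext x; simp [LinearMap.funLeft]⟩

lemma finiteDimensional_translateSpan_add {f₁ f₂ : G → E}
    (h₁ : FiniteDimensional ℂ (translateSpan f₁)) (h₂ : FiniteDimensional ℂ (translateSpan f₂)) :
    FiniteDimensional ℂ (translateSpan (f₁ + f₂)) :=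
  finiteDimensional_translateSpan_of_mem (translateSpan f₁ ⊔ translateSpan f₂) fun g => by
    rw [map_add]
    exact Submodule.add_mem_sup (shift_mem_translateSpan _ g) (shift_mem_translateSpan _ g)

lemma finiteDimensional_translateSpan_mul {f₁ f₂ : G → ℂ}
    (h₁ : FiniteDimensional ℂ (translateSpan f₁)) (h₂ : FiniteDimensional ℂ (translateSpan f₂)) :
    FiniteDimensional ℂ (translateSpan (f₁ * f₂)) := by
  have : FiniteDimensional ℂ ↥(translateSpan f₁ * translateSpan f₂) :=
    Module.Finite.iff_fg.2 ((Module.Finite.iff_fg.1 h₁).mul (Module.Finite.iff_fg.1 h₂))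
  exact finiteDimensional_translateSpan_of_mem (translateSpan f₁ * translateSpan f₂) fun g =>
    Submodule.mul_mem_mul (shift_mem_translateSpan f₁ g) (shift_mem_translateSpan f₂ g)

lemma finiteDimensional_translateSpan_const (c : ℂ) :
    FiniteDimensional ℂ (translateSpan fun _ : G => c) :=
  finiteDimensional_translateSpan_of_mem (Submodule.span ℂ {fun _ : G => c}) fun _ =>
    Submodule.subset_span rfl

lemma finiteDimensional_translateSpan_sum {ι : Type*} (s : Finset ι) {f : ι → G → ℂ}
    (h : ∀ i ∈ s, FiniteDimensional ℂ (translateSpan (f i))) :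
    FiniteDimensional ℂ (translateSpan (∑ i ∈ s, f i)) :=
  Finset.sum_induction f (fun f => FiniteDimensional ℂ (translateSpan f))
    (fun _ _ => finiteDimensional_translateSpan_add) (finiteDimensional_translateSpan_const 0) h

lemma finiteDimensional_translateSpan_addMonoidHom (a : G →+ ℂ) :
    FiniteDimensional ℂ (translateSpan a) := by
  have : FiniteDimensional ℂ (Submodule.span ℂ {(a : G → ℂ), 1}) :=
    FiniteDimensional.span_of_finite ℂ (by simp)
  refine finiteDimensional_translateSpan_of_mem (Submodule.span ℂ {(a : G → ℂ), 1}) fun g => ?_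
  exact Submodule.mem_span_pair.2 ⟨1, a g, by ext x; simp⟩

lemma finiteDimensional_translateSpan_of_multiplicative {m : G → ℂ}
    (hm : ∀ x y, m (x + y) = m x * m y) : FiniteDimensional ℂ (translateSpan m) :=
  finiteDimensional_translateSpan_of_mem (Submodule.span ℂ {m}) fun g =>
    Submodule.mem_span_singleton.2 ⟨m g, by ext x; simp [hm, mul_comm]⟩

lemma finiteDimensional_translateSpan_eval {n : ℕ} (a : Fin n → (G →+ ℂ))
    (P : MvPolynomial (Fin n) ℂ) :
    FiniteDimensional ℂ (translateSpan fun x => MvPolynomial.eval (fun i => a i x) P) := by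
  induction P using MvPolynomial.induction_on with
  | C c =>
    rw [show (fun x => MvPolynomial.eval (fun i => a i x) (MvPolynomial.C c)) = fun _ => c from
      funext fun x => MvPolynomial.eval_C c]
    exact finiteDimensional_translateSpan_const c
  | add P Q hP hQ =>
    rw [show (fun x => MvPolynomial.eval (fun i => a i x) (P + Q)) =
      (fun x => MvPolynomial.eval (fun i => a i x) P) +
        fun x => MvPolynomial.eval (fun i => a i x) Q from funext fun x => map_add _ P Q]
    exact finiteDimensional_translateSpan_add hP hQ
  | mul_X P i hP =>
    rw [show (fun x => MvPolynomial.eval (fun i => a i x) (P * MvPolynomial.X i)) =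
      (fun x => MvPolynomial.eval (fun i => a i x) P) * a i from
        funext fun x => by simp only [map_mul, MvPolynomial.eval_X, Pi.mul_apply]]
    exact finiteDimensional_translateSpan_mul hP (finiteDimensional_translateSpan_addMonoidHom _)

end Shift

lemma IsComplexExpPolynomial.finiteDimensional_translateSpan {G : Type*} [AddCommMonoid G]
    [TopologicalSpace G] {f : G → ℂ} (hf : IsComplexExpPolynomial f) :
    FiniteDimensional ℂ (translateSpan f) := by
  obtain ⟨n, p, m, hp, hm, hf⟩ := hf
  obtain rfl : f = ∑ i, p i * m i := by
    ext x
    simp [hf]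
  refine finiteDimensional_translateSpan_sum _ fun i _ => finiteDimensional_translateSpan_mul ?_
    (finiteDimensional_translateSpan_of_multiplicative (hm i).2.2)
  obtain ⟨k, a, P, -, h⟩ := hp i
  rw [show p i = _ from funext h]
  exact finiteDimensional_translateSpan_eval a P

/-- Induction on the dimension: if some `f i` is not scalar on `V`, its eigenspace cuts `V` down
strictly, commutation keeps the intersection invariant, and the last nonzero vector `(f i - χ i) ^ k
v` shows that it is nonzero. -/
lemma exists_common_eigenvector {ι M : Type*} [AddCommGroup M] [Module ℂ M]
    (f : ι → Module.End ℂ M) (hf : ∀ i j, Commute (f i) (f j)) (χ : ι → ℂ) (V : Submodule ℂ M)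
    [FiniteDimensional ℂ V] (hV : V ≠ ⊥) (hinv : ∀ i, ∀ v ∈ V, f i v ∈ V)
    (hgen : ∀ i, V ≤ (f i).maxGenEigenspace (χ i)) :
    ∃ v ∈ V, v ≠ 0 ∧ ∀ i, f i v = χ i • v := by
  generalize hn : finrank ℂ V = n
  induction n using Nat.strong_induction_on generalizing V with
  | _ n ih =>
  obtain ⟨v, hv, hv0⟩ := (Submodule.ne_bot_iff _).1 hV
  by_cases hall : ∀ i, V ≤ (f i).eigenspace (χ i)
  · exact ⟨v, hv, hv0, fun i => Module.End.mem_eigenspace_iff.1 (hall i hv)⟩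
  push Not at hall
  obtain ⟨i, hi⟩ := hall
  set D : Module.End ℂ M := f i - χ i • (1 : Module.End ℂ M) with hD
  have hDV : ∀ k, (D ^ k) v ∈ V := by
    intro k
    induction k with
    | zero => simpa
    | succ k ihk =>
      rw [pow_succ', Module.End.mul_apply]
      exact V.sub_mem (hinv i _ ihk) (V.smul_mem _ ihk)
  have hlt : V ⊓ (f i).eigenspace (χ i) < V := inf_lt_left.2 hi
  have hex : ∃ k, (D ^ k) v = 0 := (Module.End.mem_maxGenEigenspace _ _ _).1 (hgen i hv)
  classical
  refine (fun ⟨w, hw, h⟩ => ⟨w, hw.1, h⟩) (ih _ (hn ▸ Submodule.finrank_lt_finrank_of_lt hlt)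
    (V ⊓ (f i).eigenspace (χ i)) ?_ ?_ ?_ rfl)
  · obtain ⟨k, hk⟩ : ∃ k, Nat.find hex = k + 1 := Nat.exists_eq_succ_of_ne_zero fun h0 => by
      have := Nat.find_spec hex
      rw [h0] at this
      exact hv0 (by simpa using this)
    refine (Submodule.ne_bot_iff _).2 ⟨(D ^ k) v, ⟨hDV k, ?_⟩, Nat.find_min hex (by lia)⟩
    have := Nat.find_spec hex
    rw [hk, pow_succ', Module.End.mul_apply, hD] at this
    rw [SetLike.mem_coe, Module.End.mem_eigenspace_iff]
    simpa [sub_eq_zero] using this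
  · rintro j w ⟨hw, hw'⟩
    refine ⟨hinv j w hw, ?_⟩
    rw [SetLike.mem_coe, Module.End.mem_eigenspace_iff] at hw' ⊢
    rw [← Module.End.mul_apply, (hf i j).eq, Module.End.mul_apply, hw', map_smul]
  · exact fun j => inf_le_left.trans (hgen j)

/-! ### Joint generalized eigenspaces of the translations -/

section Spectral

variable {G : Type*} [AddCommMonoid G]

/-- The functions that are generalized eigenvectors of all translations, with eigenvalues `χ`. -/
def jointGenEigenspace (χ : G → ℂ) : Submodule ℂ (G → ℂ) :=
  ⨅ g, (shift ℂ g).maxGenEigenspace (χ g)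

lemma iSupIndep_jointGenEigenspace : iSupIndep (jointGenEigenspace (G := G)) :=
  Module.End.independent_iInf_maxGenEigenspace_of_forall_mapsTo _ fun i j φ =>
    Module.End.mapsTo_maxGenEigenspace_of_comm (shift_commute j i) φ

lemma shift_mem_jointGenEigenspace {χ φ : G → ℂ} (hφ : φ ∈ jointGenEigenspace χ) (g : G) :
    shift ℂ g φ ∈ jointGenEigenspace χ := by
  simp only [jointGenEigenspace, Submodule.mem_iInf] at hφ ⊢
  exact fun h => Module.End.mapsTo_maxGenEigenspace_of_comm (shift_commute h g) _ (hφ h)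

lemma le_iSup_inf_jointGenEigenspace (V : Submodule ℂ (G → ℂ)) [FiniteDimensional ℂ V]
    (hV : ∀ g, ∀ v ∈ V, shift ℂ g v ∈ V) :
    V ≤ ⨆ χ, V ⊓ jointGenEigenspace χ := by
  have key := Module.End.iSup_iInf_maxGenEigenspace_eq_top_of_iSup_maxGenEigenspace_eq_top_of_commute
    (fun g => (shift ℂ g).restrict (hV g))
    (fun g h _ => LinearMap.ext fun v => Subtype.ext
      (LinearMap.congr_fun (shift_commute g h).eq v.1))
    (fun g => Module.End.iSup_maxGenEigenspace_eq_top _)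
  have h2 := congrArg (Submodule.map V.subtype) key
  rw [Submodule.map_iSup, Submodule.map_top, Submodule.range_subtype] at h2
  conv_lhs => rw [← h2]
  refine iSup_mono fun χ => ?_
  rw [jointGenEigenspace, Submodule.inf_iInf_maxGenEigenspace_of_forall_mapsTo _ _ hV]

/-- On `V` the generalized eigenspaces stabilize by exponent `dim V`, so one exponent serves every
`g`. -/
lemma pow_apply_eq_zero_of_mem_inf_jointGenEigenspace (V : Submodule ℂ (G → ℂ)) [FiniteDimensional ℂ V]
    (hV : ∀ g, ∀ v ∈ V, shift ℂ g v ∈ V) {χ φ : G → ℂ}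
    (hφ : φ ∈ V ⊓ jointGenEigenspace χ) {N : ℕ} (hN : finrank ℂ V ≤ N) (g : G) :
    ((shift ℂ g - χ g • (1 : Module.End ℂ (G → ℂ))) ^ N) φ = 0 := by
  have h1 : φ ∈ V ⊓ (shift ℂ g).maxGenEigenspace (χ g) :=
    ⟨hφ.1, (Submodule.mem_iInf _).1 hφ.2 g⟩
  rw [Submodule.inf_genEigenspace _ _ (hV g)] at h1
  obtain ⟨w, hw, rfl⟩ := h1
  have hw2 : w ∈ Module.End.genEigenspace ((shift ℂ g).restrict (hV g)) (χ g) (N : ℕ∞) := by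
    rw [Module.End.genEigenspace_eq_genEigenspace_finrank_of_le _ _ hN,
      ← Module.End.maxGenEigenspace_eq_genEigenspace_finrank]
    exact hw
  have h3 : (w : G → ℂ) ∈ V ⊓ (shift ℂ g).genEigenspace (χ g) (N : ℕ∞) := by
    rw [Submodule.inf_genEigenspace _ _ (hV g)]
    exact ⟨w, hw2, rfl⟩
  simpa [Module.End.mem_genEigenspace_nat] using h3.2

/-- A common eigenvector `ψ` satisfies `ψ(x) = χ(x) ψ(0)`, so `χ` is a multiple of `ψ`. Membership
in `V` is what later makes `χ` continuous. -/
lemma mem_of_inf_jointGenEigenspace_ne_bot (V : Submodule ℂ (G → ℂ)) [FiniteDimensional ℂ V]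
    (hV : ∀ g, ∀ v ∈ V, shift ℂ g v ∈ V) {χ : G → ℂ}
    (h : V ⊓ jointGenEigenspace χ ≠ ⊥) :
    χ ∈ V ∧ χ 0 = 1 ∧ ∀ x y, χ (x + y) = χ x * χ y := by
  obtain ⟨ψ, hψ, hψ0, heig⟩ := exists_common_eigenvector (fun g : G => shift ℂ g) shift_commute χ
    (V ⊓ jointGenEigenspace χ) h (fun g v hv => ⟨hV g v hv.1, shift_mem_jointGenEigenspace hv.2 g⟩)
    (fun g => inf_le_right.trans (iInf_le _ g))
  have h1 : ∀ x g, ψ (x + g) = χ g * ψ x := fun x g => congrFun (heig g) x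
  have h2 : ∀ x, ψ x = χ x * ψ 0 := fun x => by simpa using h1 0 x
  have h3 : ψ 0 ≠ 0 := fun h0 => hψ0 <| funext fun x => by simp [h2 x, h0]
  refine ⟨?_, ?_, fun x y => ?_⟩
  · have : χ = (ψ 0)⁻¹ • ψ := by
      ext x
      simp [h2 x, h3, mul_comm]
    rw [this]
    exact V.smul_mem _ hψ.1
  · exact mul_right_cancel₀ h3 (by rw [← h2, one_mul])
  · refine mul_right_cancel₀ h3 ?_
    rw [← h2, h1, h2 x]
    ring

end Spectral

/-! ### Logarithms of unipotent representations -/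

section Logarithm

variable {R : Type*} [CommRing R] [Algebra ℂ R]

/-- `R` may have zero divisors, so roots cannot be counted in `R`; linear functionals applied to the
coefficients reduce to polynomials over `ℂ`. -/
lemma polynomial_eq_of_forall_eval_natCast {P Q : Polynomial R}
    (h : ∀ n : ℕ, P.eval (n : R) = Q.eval (n : R)) : P = Q := by
  rw [← sub_eq_zero]
  set S := P - Q with hS
  have hz : ∀ n : ℕ, S.eval (n : R) = 0 := fun n => by simp [hS, h]
  ext i
  rw [Polynomial.coeff_zero, ← Module.forall_dual_apply_eq_zero_iff ℂ]
  intro u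
  set T : Polynomial ℂ :=
    ∑ j ∈ Finset.range (S.natDegree + 1), Polynomial.C (u (S.coeff j)) * Polynomial.X ^ j with hT
  have hT0 : T = 0 := by
    refine Polynomial.eq_zero_of_infinite_isRoot T
      ((Set.infinite_range_of_injective (Nat.cast_injective (R := ℂ))).mono ?_)
    rintro _ ⟨n, rfl⟩
    have := congrArg u (hz n)
    rw [Polynomial.eval_eq_sum_range, map_sum, map_zero] at this
    rw [Set.mem_ofPred_eq, Polynomial.IsRoot, hT, Polynomial.eval_finsetSum, ← this]
    refine Finset.sum_congr rfl fun j _ => ?_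
    have h1 : S.coeff j * (n : R) ^ j = ((n : ℂ) ^ j) • S.coeff j := by
      rw [Algebra.smul_def, map_pow, map_natCast, mul_comm]
    rw [h1, map_smul, Polynomial.eval_mul, Polynomial.eval_C, Polynomial.eval_pow,
      Polynomial.eval_X, smul_eq_mul, mul_comm]
  by_cases hi : i ≤ S.natDegree
  · have := congrArg (fun p : Polynomial ℂ => p.coeff i) hT0
    simpa [hT, Polynomial.finsetSum_coeff, Polynomial.coeff_X_pow, Nat.lt_succ_iff, hi] using this
  · rw [Polynomial.coeff_eq_zero_of_natDegree_lt (not_le.1 hi), map_zero]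

open Polynomial in
-- Truncated binomial series: `n.choose k` is a polynomial in `n`. The linear coefficient is the
-- truncated logarithm, with scalars `a` independent of `D`; this uniformity later gives continuity.
lemma exists_polynomial_eval_eq_pow (N : ℕ) :
    ∃ a : ℕ → ℂ, ∀ D : R, D ^ N = 0 → ∃ P : Polynomial R,
      (∀ n : ℕ, P.eval (n : R) = (1 + D) ^ n) ∧ P.natDegree ≤ N ∧
        P.coeff 1 = ∑ k ∈ Finset.range N, a k • D ^ k := by
  refine ⟨fun k => ((k.factorial : ℂ)⁻¹ * (descPochhammer ℤ k).coeff 1), fun D hD =>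
    ⟨∑ k ∈ Finset.range N, C ((k.factorial : ℂ)⁻¹ • D ^ k) * descPochhammer R k, fun n => ?_, ?_, ?_⟩⟩
  · have hterm : ∀ k, (C ((k.factorial : ℂ)⁻¹ • D ^ k) * descPochhammer R k).eval (n : R) =
        D ^ k * (n.choose k : R) := by
      intro k
      have hk : (k.factorial : ℂ) ≠ 0 := by exact_mod_cast k.factorial_ne_zero
      rw [eval_mul, eval_C, descPochhammer_eval_eq_descFactorial,
        Nat.descFactorial_eq_factorial_mul_choose, Nat.cast_mul, smul_mul_assoc,
        mul_left_comm, inv_smul_eq_iff₀ hk, Algebra.smul_def, map_natCast]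
    rw [eval_finsetSum, add_comm, add_pow]
    simp only [hterm, one_pow, mul_one]
    have hN : ∀ k, N ≤ k → D ^ k * (n.choose k : R) = 0 := fun k hk => by
      rw [pow_eq_zero_of_le hk hD, zero_mul]
    have hn : ∀ k, n + 1 ≤ k → D ^ k * (n.choose k : R) = 0 := fun k hk => by
      rw [Nat.choose_eq_zero_of_lt hk, Nat.cast_zero, mul_zero]
    rcases le_total N (n + 1) with h | h
    · exact Finset.sum_subset (Finset.range_mono h) fun k _ hk =>
        hN k (by simpa using hk)
    · exact (Finset.sum_subset (Finset.range_mono h) fun k _ hk =>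
        hn k (by simpa using hk)).symm
  · refine natDegree_sum_le_of_forall_le _ _ fun k hk => ?_
    refine (natDegree_C_mul_le _ _).trans ?_
    rw [← descPochhammer_map (Int.castRingHom R)]
    exact natDegree_map_le.trans ((descPochhammer_natDegree ℤ k).trans_le
      (Finset.mem_range.1 hk).le)
  · rw [finsetSum_coeff]
    refine Finset.sum_congr rfl fun k _ => ?_
    rw [coeff_C_mul, ← descPochhammer_map (Int.castRingHom R), coeff_map, eq_intCast,
      Algebra.smul_def, Algebra.smul_def, map_mul, map_intCast]
    ring

/-- The logarithm of a unipotent representation: it is additive, and its exponential is the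
representation. -/
lemma exists_log_of_unipotent (N : ℕ) {G : Type*} [AddCommMonoid G] (U : G → R)
    (hU0 : U 0 = 1) (hU : ∀ g h, U (g + h) = U g * U h) (hN : ∀ g, (U g - 1) ^ N = 0) :
    ∃ (a : ℕ → ℂ) (L : G →+ R), (∀ g, L g = ∑ k ∈ Finset.range N, a k • (U g - 1) ^ k) ∧
      ∀ g, U g = ∑ j ∈ Finset.range (N + 1), ((j.factorial : ℂ)⁻¹) • L g ^ j := by
  obtain ⟨a, ha⟩ := exists_polynomial_eval_eq_pow (R := R) N
  choose P hP hdeg hcoeff using fun g => ha (U g - 1) (hN g)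
  replace hP : ∀ g (n : ℕ), (P g).eval (n : R) = U g ^ n := fun g n => by
    rw [hP, add_sub_cancel]
  have hc0 : ∀ g, (P g).coeff 0 = 1 := fun g => by
    rw [Polynomial.coeff_zero_eq_eval_zero]
    simpa using hP g 0
  -- Since constant coefficients are 1, multiplicativity of `P` makes the linear coefficient
  -- additive.
  have hadd : ∀ g h, P (g + h) = P g * P h := fun g h =>
    polynomial_eq_of_forall_eval_natCast fun n => by
      rw [Polynomial.eval_mul, hP, hP, hP, hU, mul_pow]
  have hzero : P 0 = 1 := polynomial_eq_of_forall_eval_natCast fun n => by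
    rw [hP, hU0, one_pow, Polynomial.eval_one]
  have hshift : ∀ g (m : ℕ), (P g).comp (Polynomial.X + Polynomial.C (m : R)) =
      P g * Polynomial.C ((P g).eval (m : R)) := fun g m =>
    polynomial_eq_of_forall_eval_natCast fun n => by
      rw [Polynomial.eval_comp, Polynomial.eval_mul, Polynomial.eval_C, Polynomial.eval_add,
        Polynomial.eval_X, Polynomial.eval_C, ← Nat.cast_add, hP, hP, hP, pow_add]
  -- Differentiating `P(X + m) = P(X) P(m)` at `X = 0` gives the differential equation of the
  -- exponential, which determines all coefficients.
  have hder : ∀ g, Polynomial.derivative (P g) = Polynomial.C ((P g).coeff 1) * P g := fun g =>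
    polynomial_eq_of_forall_eval_natCast fun m => by
      have := congrArg (fun Q => (Polynomial.derivative Q).eval 0) (hshift g m)
      simp only [Polynomial.derivative_comp, Polynomial.derivative_mul] at this
      simp only [Polynomial.derivative_add, Polynomial.derivative_X, Polynomial.derivative_C,
        add_zero, Polynomial.eval_mul, one_mul, Polynomial.eval_comp,
        Polynomial.eval_add, Polynomial.eval_X, Polynomial.eval_C, zero_add, mul_zero] at this
      rw [this, Polynomial.eval_mul, Polynomial.eval_C, ← Polynomial.coeff_zero_eq_eval_zero,
        Polynomial.coeff_derivative]
      simp
  have hcoeffs : ∀ g j, (P g).coeff j = ((j.factorial : ℂ)⁻¹) • (P g).coeff 1 ^ j := by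
    intro g j
    induction j with
    | zero => simp [hc0]
    | succ j ih =>
      have h1 := congrArg (fun Q => Polynomial.coeff Q j) (hder g)
      simp only [Polynomial.coeff_derivative, Polynomial.coeff_C_mul] at h1
      rw [ih, mul_smul_comm, ← pow_succ'] at h1
      have hj : ((j : ℂ) + 1) ≠ 0 := by exact_mod_cast j.succ_ne_zero
      have h2 : ((j : ℂ) + 1) • (P g).coeff (j + 1) = (P g).coeff (j + 1) * ((j : R) + 1) := by
        rw [Algebra.smul_def, map_add, map_natCast, map_one, mul_comm]
      rw [← h2, ← eq_inv_smul_iff₀ hj, smul_smul] at h1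
      rw [h1, Nat.factorial_succ, Nat.cast_mul, mul_inv, Nat.cast_succ]
  refine ⟨a, ⟨⟨fun g => (P g).coeff 1, ?_⟩, fun g h => ?_⟩, hcoeff, fun g => ?_⟩
  · simp [hzero, Polynomial.coeff_one]
  · simp [hadd, Polynomial.mul_coeff_one, hc0, add_comm]
  · have := hP g 1
    rw [pow_one, Nat.cast_one, Polynomial.eval_eq_sum_range' (Nat.lt_succ_of_le (hdeg g))] at this
    rw [← this]
    refine Finset.sum_congr rfl fun j _ => ?_
    rw [one_pow, mul_one]
    exact hcoeffs g j

open scoped IsMulCommutative in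
lemma exists_log_of_unipotent_end {V : Type*} [AddCommGroup V] [Module ℂ V] (N : ℕ) {G : Type*}
    [AddCommMonoid G] (U : G → Module.End ℂ V) (hU0 : U 0 = 1)
    (hU : ∀ g h, U (g + h) = U g * U h) (hN : ∀ g, (U g - 1) ^ N = 0) :
    ∃ (a : ℕ → ℂ) (L : G →+ Module.End ℂ V),
      (∀ g, L g = ∑ k ∈ Finset.range N, a k • (U g - 1) ^ k) ∧
      ∀ g, U g = ∑ j ∈ Finset.range (N + 1), ((j.factorial : ℂ)⁻¹) • L g ^ j := by
  -- The commutative case applies inside the algebra generated by the commuting operators `U g`.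
  have : IsMulCommutative (Algebra.adjoin ℂ (Set.range U)) :=
    Algebra.isMulCommutative_adjoin ℂ (by
      rintro _ ⟨g, rfl⟩ _ ⟨h, rfl⟩
      rw [← hU, ← hU, add_comm])
  obtain ⟨a, L, hL, hexp⟩ := exists_log_of_unipotent N
    (fun g => (⟨U g, Algebra.subset_adjoin ⟨g, rfl⟩⟩ : Algebra.adjoin ℂ (Set.range U)))
    (Subtype.ext hU0) (fun g h => Subtype.ext (hU g h)) (fun g => Subtype.ext (by simpa using hN g))
  refine ⟨a, (Algebra.adjoin ℂ (Set.range U)).val.toRingHom.toAddMonoidHom.comp L,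
    fun g => ?_, fun g => ?_⟩
  · simpa using congrArg (Algebra.adjoin ℂ (Set.range U)).val (hL g)
  · simpa using congrArg (Algebra.adjoin ℂ (Set.range U)).val (hexp g)

end Logarithm

/-! ### Interpolation in finite dimensional function spaces -/

section Evaluation

variable {X : Type*}

lemma exists_finset_forall_eq_zero (W : Submodule ℂ (X → ℂ)) [FiniteDimensional ℂ W] :
    ∃ s : Finset X, ∀ w ∈ W, (∀ y ∈ s, w y = 0) → w = 0 := by
  classical
  generalize hn : finrank ℂ W = n
  induction n using Nat.strong_induction_on generalizing W with
  | _ n ih =>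
  by_cases hW : W = ⊥
  · exact ⟨∅, fun w hw _ => by simpa [hW] using hw⟩
  obtain ⟨w, hw, hw0⟩ := (Submodule.ne_bot_iff _).1 hW
  obtain ⟨y, hy⟩ := Function.ne_iff.1 hw0
  have hlt : W ⊓ LinearMap.ker (LinearMap.proj (R := ℂ) (φ := fun _ : X => ℂ) y) < W :=
    inf_lt_left.2 fun h => hy (h hw)
  obtain ⟨s, hs⟩ := ih _ (hn ▸ Submodule.finrank_lt_finrank_of_lt hlt)
    (W ⊓ LinearMap.ker (LinearMap.proj (R := ℂ) (φ := fun _ : X => ℂ) y)) rfl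
  refine ⟨insert y s, fun v hv h => hs v ⟨hv, h y (Finset.mem_insert_self y s)⟩ fun z hz => ?_⟩
  exact h z (Finset.mem_insert_of_mem hz)

/-- A finite dimensional space of functions has a finite interpolation formula. -/
lemma exists_interpolation (W : Submodule ℂ (X → ℂ)) [FiniteDimensional ℂ W] :
    ∃ (s : Finset X) (r : s → W), ∀ w : W, w = ∑ y : s, (w : X → ℂ) y • r y := by
  classical
  obtain ⟨s, hs⟩ := exists_finset_forall_eq_zero W
  let ρ : W →ₗ[ℂ] (s → ℂ) := (LinearMap.funLeft ℂ ℂ ((↑) : s → X)).comp W.subtype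
  have hρ : LinearMap.ker ρ = ⊥ := by
    refine LinearMap.ker_eq_bot'.2 fun w hw => Subtype.ext (hs w w.2 fun y hy => ?_)
    exact congrFun hw ⟨y, hy⟩
  obtain ⟨l, hl⟩ := ρ.exists_leftInverse_of_injective hρ
  refine ⟨s, fun y => l (Pi.single y 1), fun w => ?_⟩
  calc w = l (ρ w) := (LinearMap.congr_fun hl w).symm
    _ = l (∑ y : s, ρ w y • Pi.single y (1 : ℂ)) := by
      congr 1
      ext z
      simp [Finset.sum_apply, Pi.single_apply]
    _ = _ := by
      rw [map_sum]
      simp only [map_smul]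
      rfl

end Evaluation

lemma matrixCoeff_pow_mem {X V : Type*} [AddCommGroup V] [Module ℂ V] [FiniteDimensional ℂ V]
    (A : Subalgebra ℂ (X → ℂ)) (F : X → Module.End ℂ V)
    (hF : ∀ (l : Module.Dual ℂ V) (w : V), (fun x => l (F x w)) ∈ A) (j : ℕ) :
    ∀ (l : Module.Dual ℂ V) (w : V), (fun x => l ((F x ^ j) w)) ∈ A := by
  induction j with
  | zero =>
    intro l w
    exact A.algebraMap_mem (l w)
  | succ j ih =>
    intro l w
    let b := Module.finBasis ℂ V
    have : (fun x => l ((F x ^ (j + 1)) w)) =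
        ∑ i, (fun x => b.coord i ((F x ^ j) w)) * fun x => l (F x (b i)) := by
      ext x
      conv_lhs => rw [pow_succ', Module.End.mul_apply, ← b.sum_repr ((F x ^ j) w)]
      simp only [map_sum, map_smul, smul_eq_mul, Finset.sum_apply, Pi.mul_apply,
        Module.Basis.coord_apply]
    rw [this]
    exact A.sum_mem fun i _ => A.mul_mem (ih _ _) (hF _ _)

/-! ### Untwisting by a character -/

section Twist

variable {G : Type*} [AddCommGroup G]

lemma shift_sub_one_pow_mul {χ : G → ℂ} (h0 : χ 0 = 1) (hχ : ∀ x y, χ (x + y) = χ x * χ y)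
    (g : G) (k : ℕ) (φ : G → ℂ) :
    ((shift ℂ g - 1) ^ k) ((fun x => χ (-x)) * φ) =
      (fun x => χ (-x)) * (χ (-g) ^ k • ((shift ℂ g - χ g • (1 : Module.End ℂ (G → ℂ))) ^ k) φ) := by
  have hg : χ (-g) * χ g = 1 := by rw [← hχ, neg_add_cancel, h0]
  induction k with
  | zero => simp
  | succ k ih =>
    rw [pow_succ', Module.End.mul_apply, ih, pow_succ' (shift ℂ g - _), Module.End.mul_apply]
    ext x
    simp only [LinearMap.sub_apply, Module.End.one_apply, Pi.sub_apply, shift_apply, Pi.mul_apply,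
      Pi.smul_apply, smul_eq_mul, LinearMap.smul_apply, neg_add, hχ]
    linear_combination (χ (-x) * χ (-g) ^ k *
      ((shift ℂ g - χ g • (1 : Module.End ℂ (G → ℂ))) ^ k) φ x) * hg

end Twist

/-! ### Unipotent functions are polynomials -/

section Polynomial

variable {G : Type*} [TopologicalSpace G]

lemma isComplexPolynomial_of_mem_adjoin [AddCommMonoid G] {f : G → ℂ}
    (hf : f ∈ Algebra.adjoin ℂ
      (Set.range fun a : {a : G →+ ℂ // Continuous a} => (a.1 : G → ℂ))) :
    IsComplexPolynomial f := by
  rw [Algebra.adjoin_range_eq_range_aeval] at hf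
  obtain ⟨P, rfl⟩ := hf
  obtain ⟨n, i, -, Q, rfl⟩ := MvPolynomial.exists_fin_rename P
  refine ⟨n, fun k => (i k).1, Q, fun k => (i k).2, fun x => ?_⟩
  have := MvPolynomial.comp_aeval_apply (R := ℂ)
    (fun k => ((i k).1 : G → ℂ)) (Pi.evalAlgHom ℂ (fun _ : G => ℂ) x) Q
  simp only [Pi.evalAlgHom_apply] at this
  change MvPolynomial.aeval (fun a : {a : G →+ ℂ // Continuous a} => (a.1 : G → ℂ))
    (MvPolynomial.rename i Q) x = _
  rw [MvPolynomial.aeval_rename]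
  change MvPolynomial.aeval (fun k => ((i k).1 : G → ℂ)) Q x = _
  rw [this, MvPolynomial.aeval_def, Algebra.algebraMap_self, MvPolynomial.eval₂_id]

lemma isComplexPolynomial_of_unipotent [AddCommGroup G] [IsTopologicalAddGroup G] {p : G → ℂ}
    (hp : Continuous p) [FiniteDimensional ℂ (translateSpan p)] {N : ℕ}
    (hN : ∀ g, ((shift ℂ g - 1) ^ N) p = 0) : IsComplexPolynomial p := by
  have hcont : ∀ w ∈ translateSpan p, Continuous w := by
    suffices translateSpan p ≤ Subalgebra.toSubmodule (continuousSubalgebra (α := G) (R := ℂ)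
      (A := ℂ)) from fun w hw => this hw
    exact translateSpan_le fun g => hp.comp (continuous_add_const g)
  have hker : ∀ g, translateSpan p ≤ LinearMap.ker ((shift ℂ g - 1) ^ N) := fun g =>
    translateSpan_le fun h => by
      have hc : Commute ((shift ℂ g - 1) ^ N) (shift ℂ h) :=
        ((shift_commute g h).sub_left (Commute.one_left _)).pow_left N
      rw [LinearMap.mem_ker, ← Module.End.mul_apply, hc.eq, Module.End.mul_apply, hN, map_zero]
  let U : G → Module.End ℂ (translateSpan p) := fun g =>
    (shift ℂ g).restrict fun _ => shift_mapsTo_translateSpan p g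
  have hU0 : U 0 = 1 := by
    ext w x
    simp [U]
  have hUadd : ∀ g h, U (g + h) = U g * U h := fun g h => by
    ext w x
    simp [U, ← shift_mul]
  have hUN : ∀ g, (U g - 1) ^ N = 0 := fun g => by
    have hpow : ∀ (k : ℕ) (w : translateSpan p),
        (((U g - 1) ^ k : Module.End ℂ (translateSpan p)) w : G → ℂ) =
          ((shift ℂ g - 1) ^ k : Module.End ℂ (G → ℂ)) (w : G → ℂ) := by
      intro k
      induction k with
      | zero => exact fun _ => rfl
      | succ k ih =>
        intro w
        rw [pow_succ, pow_succ, Module.End.mul_apply, Module.End.mul_apply, ih]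
        rfl
    exact LinearMap.ext fun w => Subtype.ext ((hpow N w).trans (hker g w.2))
  -- By interpolation, a matrix coefficient is a linear combination of the continuous functions `x ↦
  -- w (y + x)`.
  have hUcont : ∀ (l : Module.Dual ℂ (translateSpan p)) (w : translateSpan p),
      Continuous fun x => l (U x w) := by
    obtain ⟨s, r, hr⟩ := exists_interpolation (translateSpan p)
    intro l w
    have : (fun x => l (U x w)) = fun x => ∑ y : s, (w : G → ℂ) (y + x) * l (r y) := by
      ext x
      conv_lhs => rw [hr (U x w), map_sum]
      simp [U]
    rw [this]
    exact continuous_finsetSum _ fun y _ =>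
      ((hcont w w.2).comp (continuous_const_add _)).mul continuous_const
  obtain ⟨a, L, hL, hexp⟩ := exists_log_of_unipotent_end N U hU0 hUadd hUN
  have hDcont : ∀ (k : ℕ) (l : Module.Dual ℂ (translateSpan p)) (w : translateSpan p),
      Continuous fun x => l (((U x - 1) ^ k) w) :=
    matrixCoeff_pow_mem (continuousSubalgebra (α := G) (R := ℂ) (A := ℂ)) (fun x => U x - 1)
      fun l w => by
        change Continuous fun x => l (U x w - w)
        simp only [map_sub]
        exact Continuous.sub (hUcont l w) (continuous_const (y := l w))
  have hLmem : ∀ (l : Module.Dual ℂ (translateSpan p)) (w : translateSpan p),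
      (fun x => l (L x w)) ∈ Algebra.adjoin ℂ
        (Set.range fun a : {a : G →+ ℂ // Continuous a} => (a.1 : G → ℂ)) := by
    intro l w
    refine Algebra.subset_adjoin ⟨⟨⟨⟨fun x => l (L x w), ?_⟩, fun x y => ?_⟩, ?_⟩, rfl⟩
    · simp
    · simp
    · change Continuous fun x => l (L x w)
      simp only [hL, LinearMap.sum_apply, map_sum, LinearMap.smul_apply, map_smul]
      refine continuous_finsetSum _ fun k _ => ?_
      change Continuous (a k • fun x => l (((U x - 1) ^ k) w))
      exact (hDcont k l w).const_smul _
  refine isComplexPolynomial_of_mem_adjoin ?_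
  -- `p` is itself a matrix coefficient: translate `p` by `x`, then evaluate at 0.
  let l : Module.Dual ℂ (translateSpan p) :=
    (LinearMap.proj (R := ℂ) (φ := fun _ : G => ℂ) 0).comp (translateSpan p).subtype
  let w : translateSpan p := ⟨p, self_mem_translateSpan p⟩
  have hpw : p = ∑ j ∈ Finset.range (N + 1),
      ((j.factorial : ℂ)⁻¹) • fun x => l ((L x ^ j) w) := by
    ext x
    have h1 : p x = l (U x w) := by simp [l, w, U]
    rw [h1, hexp]
    simp only [LinearMap.sum_apply, map_sum, LinearMap.smul_apply, map_smul, Finset.sum_apply,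
      Pi.smul_apply]
  rw [hpw]
  exact Subalgebra.sum_mem _ fun j _ => Subalgebra.smul_mem _ (matrixCoeff_pow_mem _ _ hLmem j l w) _

end Polynomial

/-! ### Scalar functions with finite dimensional translate span -/

section ExpPolynomial

variable {G : Type*} [TopologicalSpace G]

lemma IsComplexExpPolynomial.zero [AddCommMonoid G] :
    IsComplexExpPolynomial (0 : G → ℂ) :=
  ⟨0, Fin.elim0, Fin.elim0, fun i => i.elim0, fun i => i.elim0, fun x => by simp⟩

lemma IsComplexExpPolynomial.add [AddCommMonoid G] {f₁ f₂ : G → ℂ}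
    (h₁ : IsComplexExpPolynomial f₁) (h₂ : IsComplexExpPolynomial f₂) :
    IsComplexExpPolynomial (f₁ + f₂) := by
  obtain ⟨n₁, p₁, m₁, hp₁, hm₁, e₁⟩ := h₁
  obtain ⟨n₂, p₂, m₂, hp₂, hm₂, e₂⟩ := h₂
  refine ⟨n₁ + n₂, Fin.append p₁ p₂, Fin.append m₁ m₂, fun i => ?_, fun i => ?_, fun x => ?_⟩
  · refine Fin.addCases (fun i => ?_) (fun i => ?_) i
    · simpa using hp₁ i
    · simpa using hp₂ i
  · refine Fin.addCases (fun i => ?_) (fun i => ?_) i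
    · simpa using hm₁ i
    · simpa using hm₂ i
  · simp [Fin.sum_univ_add, e₁, e₂]

lemma isComplexExpPolynomial_of_finiteDimensional [AddCommGroup G] [IsTopologicalAddGroup G]
    {f : G → ℂ} (hf : Continuous f) [FiniteDimensional ℂ (translateSpan f)] :
    IsComplexExpPolynomial f := by
  have hcont : ∀ w ∈ translateSpan f, Continuous w := by
    suffices translateSpan f ≤ Subalgebra.toSubmodule (continuousSubalgebra (α := G) (R := ℂ)
      (A := ℂ)) from fun w hw => this hw
    exact translateSpan_le fun g => hf.comp (continuous_add_const g)
  have hinv : ∀ g, ∀ v ∈ translateSpan f, shift ℂ g v ∈ translateSpan f :=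
    fun g v hv => shift_mapsTo_translateSpan f g hv
  have hmem := le_iSup_inf_jointGenEigenspace _ hinv (self_mem_translateSpan f)
  refine Submodule.iSup_induction _ (motive := IsComplexExpPolynomial) hmem (fun χ ψ hψ => ?_)
    IsComplexExpPolynomial.zero fun _ _ => IsComplexExpPolynomial.add
  by_cases h0 : translateSpan f ⊓ jointGenEigenspace χ = ⊥
  · rw [h0, Submodule.mem_bot] at hψ
    exact hψ ▸ IsComplexExpPolynomial.zero
  obtain ⟨hχ, hχ0, hχm⟩ := mem_of_inf_jointGenEigenspace_ne_bot _ hinv h0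
  have hχc := hcont χ hχ
  have hχexp : IsExponential χ := ⟨hχc, fun h => by simp [h] at hχ0, hχm⟩
  have hψfd : FiniteDimensional ℂ (translateSpan ψ) :=
    finiteDimensional_translateSpan_of_mem (translateSpan f) fun g => hinv g ψ hψ.1
  have hfd : FiniteDimensional ℂ (translateSpan ((fun x => χ (-x)) * ψ)) :=
    finiteDimensional_translateSpan_mul (finiteDimensional_translateSpan_of_multiplicative
      fun x y => by rw [neg_add, hχm]) hψfd
  have hp : IsComplexPolynomial ((fun x => χ (-x)) * ψ) :=
    isComplexPolynomial_of_unipotent ((hχc.comp continuous_neg).mul (hcont ψ hψ.1))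
      (N := finrank ℂ (translateSpan f)) fun g => by
        rw [shift_sub_one_pow_mul hχ0 hχm,
          pow_apply_eq_zero_of_mem_inf_jointGenEigenspace _ hinv hψ le_rfl, smul_zero, mul_zero]
  refine ⟨1, fun _ => (fun x => χ (-x)) * ψ, fun _ => χ, fun _ => hp, fun _ => hχexp, fun x => ?_⟩
  have hx : χ (-x) * χ x = 1 := by rw [← hχm, neg_add_cancel, hχ0]
  simp only [Finset.univ_unique, Finset.sum_singleton, Pi.mul_apply]
  linear_combination (-ψ x) * hx

end ExpPolynomial

/-! ### Finite rank bounds the generalized eigenfunctions -/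

section UnipotentSpace

variable {H : Type*} [AddCommGroup H]

/-- The functions killed by `(T_g - χ(g)) ^ N` for every translation `T_g`. -/
def genEigenfunctions (χ : H → ℂ) (N : ℕ) : Submodule ℂ (H → ℂ) :=
  ⨅ g, LinearMap.ker ((shift ℂ g - χ g • (1 : Module.End ℂ (H → ℂ))) ^ N)

lemma mem_genEigenfunctions {χ : H → ℂ} {N : ℕ} {φ : H → ℂ} :
    φ ∈ genEigenfunctions χ N ↔
      ∀ g, ((shift ℂ g - χ g • (1 : Module.End ℂ (H → ℂ))) ^ N) φ = 0 := by
  simp [genEigenfunctions]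

lemma shift_mem_genEigenfunctions {χ : H → ℂ} {N : ℕ} {φ : H → ℂ}
    (hφ : φ ∈ genEigenfunctions χ N) (h : H) : shift ℂ h φ ∈ genEigenfunctions χ N := by
  rw [mem_genEigenfunctions] at hφ ⊢
  intro g
  have hc : Commute ((shift ℂ g - χ g • (1 : Module.End ℂ (H → ℂ))) ^ N) (shift ℂ h) :=
    ((shift_commute g h).sub_left ((Commute.one_left _).smul_left _)).pow_left N
  rw [← Module.End.mul_apply, hc.eq, Module.End.mul_apply, hφ, map_zero]

open Polynomial in
-- Newton's forward difference expansion of `T_g ^ n = (1 + D) ^ n`, cut off because `D ^ N` kills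
-- `p`.
lemma exists_polynomial_of_mem_genEigenfunctions {N : ℕ} {p : H → ℂ}
    (hp : p ∈ genEigenfunctions 1 N) (y g : H) :
    ∃ q : Polynomial ℂ, q.natDegree ≤ N ∧ ∀ n : ℕ, p (y + n • g) = q.eval (n : ℂ) := by
  set D : Module.End ℂ (H → ℂ) := shift ℂ g - 1 with hD
  have hDN : (D ^ N) p = 0 := by simpa [hD] using mem_genEigenfunctions.1 hp g
  refine ⟨∑ k ∈ Finset.range N, C ((k.factorial : ℂ)⁻¹ * (D ^ k) p y) * descPochhammer ℂ k,
    ?_, fun n => ?_⟩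
  · refine natDegree_sum_le_of_forall_le _ _ fun k hk => (natDegree_C_mul_le _ _).trans ?_
    exact (descPochhammer_natDegree ℂ k).trans_le (Finset.mem_range.1 hk).le
  · have hterm : ∀ k, (C ((k.factorial : ℂ)⁻¹ * (D ^ k) p y) * descPochhammer ℂ k).eval (n : ℂ) =
        n.choose k * (D ^ k) p y := by
      intro k
      have hk : (k.factorial : ℂ) ≠ 0 := by exact_mod_cast k.factorial_ne_zero
      rw [eval_mul, eval_C, descPochhammer_eval_eq_descFactorial,
        Nat.descFactorial_eq_factorial_mul_choose, Nat.cast_mul]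
      field_simp
    rw [eval_finsetSum]
    simp only [hterm]
    have h1 : p (y + n • g) = ∑ k ∈ Finset.range (n + 1), (n.choose k : ℂ) * (D ^ k) p y := by
      have : p (y + n • g) = ((D + 1) ^ n) p y := by
        rw [hD, sub_add_cancel, shift_pow, shift_apply]
      rw [this, (Commute.one_right D).add_pow]
      simp [LinearMap.sum_apply, Finset.sum_apply, ← Nat.cast_comm, Module.End.mul_apply]
    rw [h1]
    have hN : ∀ k, N ≤ k → (n.choose k : ℂ) * (D ^ k) p y = 0 := fun k hk => by
      rw [← Nat.sub_add_cancel hk, pow_add, Module.End.mul_apply, hDN, map_zero, Pi.zero_apply,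
        mul_zero]
    have hn : ∀ k, n + 1 ≤ k → (n.choose k : ℂ) * (D ^ k) p y = 0 := fun k hk => by
      rw [Nat.choose_eq_zero_of_lt hk, Nat.cast_zero, zero_mul]
    rcases le_total N (n + 1) with h | h
    · exact (Finset.sum_subset (Finset.range_mono h) fun k _ hk => hN k (by simpa using hk)).symm
    · exact Finset.sum_subset (Finset.range_mono h) fun k _ hk => hn k (by simpa using hk)

lemma eq_zero_nat_of_mem_genEigenfunctions {N : ℕ} {p : H → ℂ}
    (hp : p ∈ genEigenfunctions 1 N) {y g : H} (h : ∀ n ≤ N, p (y + n • g) = 0) (n : ℕ) :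
    p (y + n • g) = 0 := by
  obtain ⟨q, hq, hqe⟩ := exists_polynomial_of_mem_genEigenfunctions hp y g
  have : q = 0 := by
    refine Polynomial.eq_zero_of_natDegree_lt_card_of_eval_eq_zero q
      (f := fun i : Fin (N + 1) => ((i : ℕ) : ℂ)) (fun i j hij => Fin.ext (Nat.cast_injective hij))
      (fun i => ?_) (by simpa using Nat.lt_succ_of_le hq)
    rw [← hqe, h _ (Nat.lt_succ_iff.1 i.2)]
  simp [hqe, this]

lemma eq_zero_int_of_mem_genEigenfunctions {N : ℕ} {p : H → ℂ}
    (hp : p ∈ genEigenfunctions 1 N) {y g : H} (h : ∀ n ≤ N, p (y + n • g) = 0) (z : ℤ) :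
    p (y + z • g) = 0 := by
  have hnat := eq_zero_nat_of_mem_genEigenfunctions hp h
  obtain ⟨k, rfl | rfl⟩ := z.eq_nat_or_neg
  · simpa using hnat k
  -- Walking backwards from `y + N • g` meets the same `N + 1` zeros; `N + k` steps reach `y - k •
  -- g`.
  · have := eq_zero_nat_of_mem_genEigenfunctions hp (y := y + N • g) (g := -g) (fun n hn => by
      obtain ⟨d, rfl⟩ := Nat.exists_eq_add_of_le hn
      rw [← hnat d]
      congr 1
      rw [add_smul, smul_neg]
      abel) (N + k)
    rw [← this]
    congr 1
    simp only [smul_neg, add_smul, neg_smul, natCast_zsmul]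
    abel

/-- Each new generator `a` replaces a determining set `s` by the points `y + n • a` with `n ≤ N`,
enough to force vanishing along the whole direction `a`. -/
lemma exists_finset_forall_mem_span (N : ℕ) (t : Finset H) :
    ∃ s : Finset H, ∀ p ∈ genEigenfunctions (H := H) 1 N, (∀ y ∈ s, p y = 0) →
      ∀ y ∈ Submodule.span ℤ (t : Set H), p y = 0 := by
  classical
  induction t using Finset.induction_on with
  | empty =>
    refine ⟨{0}, fun p _ h y hy => ?_⟩
    obtain rfl : y = 0 := by simpa using hy
    exact h 0 (Finset.mem_singleton_self 0)
  | insert a t _ ih =>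
    obtain ⟨s, hs⟩ := ih
    refine ⟨(s ×ˢ Finset.range (N + 1)).image fun yn => yn.1 + yn.2 • a, fun p hp h y hy => ?_⟩
    rw [Finset.coe_insert, Submodule.mem_span_insert] at hy
    obtain ⟨z, w, hw, rfl⟩ := hy
    rw [add_comm]
    refine eq_zero_int_of_mem_genEigenfunctions hp (fun n hn => ?_) z
    refine hs _ (shift_mem_genEigenfunctions hp (n • a)) (fun y hy => ?_) w hw
    exact h _ (Finset.mem_image.2 ⟨(y, n), by simp [hy, Nat.lt_succ_of_le hn], rfl⟩)

lemma exists_finset_forall_smul_mem_span (hH : Module.rank ℤ H < Cardinal.aleph0) :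
    ∃ t : Finset H, ∀ x : H, ∃ n : ℕ, n ≠ 0 ∧ n • x ∈ Submodule.span ℤ (t : Set H) := by
  obtain ⟨s, hs, hmax⟩ := exists_maximal_linearIndepOn ℤ (id : H → H)
  have hfin : s.Finite := Cardinal.lt_aleph0_iff_set_finite.1
    (lt_of_le_of_lt (LinearIndependent.cardinal_le_rank hs) hH)
  refine ⟨hfin.toFinset, fun x => ?_⟩
  rw [hfin.coe_toFinset]
  by_cases hx : x ∈ s
  · exact ⟨1, one_ne_zero, by simpa using Submodule.subset_span hx⟩
  obtain ⟨a, ha, hax⟩ := hmax x hx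
  rw [Set.image_id] at hax
  refine ⟨a.natAbs, Int.natAbs_ne_zero.2 ha, ?_⟩
  rw [← natCast_zsmul]
  rcases Int.natAbs_eq a with h | h
  · rwa [← h]
  · rw [← neg_mem_iff, ← neg_smul, ← h]
    exact hax

/-- Vanishing on a finite set forces vanishing on a finitely generated subgroup containing a nonzero
multiple of every `x`. The polynomial along `x` then has infinitely many zeros. -/
lemma finiteDimensional_genEigenfunctions_one (hH : Module.rank ℤ H < Cardinal.aleph0) (N : ℕ) :
    FiniteDimensional ℂ (genEigenfunctions (H := H) 1 N) := by
  obtain ⟨t, ht⟩ := exists_finset_forall_smul_mem_span hH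
  obtain ⟨s, hs⟩ := exists_finset_forall_mem_span N t
  refine FiniteDimensional.of_injective ((LinearMap.funLeft ℂ ℂ ((↑) : s → H)).comp
    (genEigenfunctions (H := H) 1 N).subtype) ?_
  refine LinearMap.ker_eq_bot.1 (LinearMap.ker_eq_bot'.2 fun p hp => Subtype.ext (funext fun x => ?_))
  have hK := hs p p.2 fun y hy => congrFun hp ⟨y, hy⟩
  obtain ⟨n, hn, hx⟩ := ht x
  obtain ⟨q, -, hq⟩ := exists_polynomial_of_mem_genEigenfunctions p.2 0 x
  have hq0 : q = 0 := by
    refine Polynomial.eq_zero_of_infinite_isRoot q ((Set.infinite_range_of_injective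
      (f := fun j : ℕ => ((j * n : ℕ) : ℂ)) fun i j hij => ?_).mono ?_)
    · exact Nat.eq_of_mul_eq_mul_right (Nat.pos_of_ne_zero hn) (Nat.cast_injective hij)
    · rintro _ ⟨j, rfl⟩
      change q.eval _ = 0
      rw [← hq, zero_add, mul_smul]
      exact hK _ (Submodule.smul_of_tower_mem _ j hx)
  have := hq 1
  simpa [hq0] using this

lemma finiteDimensional_genEigenfunctions (hH : Module.rank ℤ H < Cardinal.aleph0) {χ : H → ℂ}
    (h0 : χ 0 = 1) (hχ : ∀ x y, χ (x + y) = χ x * χ y) (N : ℕ) :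
    FiniteDimensional ℂ (genEigenfunctions χ N) := by
  have := finiteDimensional_genEigenfunctions_one hH N
  refine Submodule.finiteDimensional_of_le
    (S₂ := (genEigenfunctions (H := H) 1 N).map (LinearMap.mulLeft ℂ χ)) fun φ hφ => ?_
  refine ⟨(fun x => χ (-x)) * φ, mem_genEigenfunctions.2 fun g => ?_, ?_⟩
  · rw [Pi.one_apply, one_smul, shift_sub_one_pow_mul h0 hχ, mem_genEigenfunctions.1 hφ, smul_zero,
      mul_zero]
  · ext x
    have hx : χ x * χ (-x) = 1 := by rw [← hχ, add_neg_cancel, h0]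
    simp [← mul_assoc, hx]

end UnipotentSpace

/-! ### A uniform dimension bound by Baire category -/

section Baire

variable {H : Type*} [AddCommGroup H]

/-- Any `n` translates of `ψ` satisfy a linear relation with normalized coefficients. -/
def TranslatesDependent (n : ℕ) (ψ : H → ℂ) : Prop :=
  ∀ y : Fin n → H, ∃ c : Metric.sphere (0 : Fin n → ℂ) 1, ∀ x, ∑ j, c.1 j * ψ (x + y j) = 0

lemma TranslatesDependent.finrank_le {n : ℕ} {ψ : H → ℂ} (h : TranslatesDependent n ψ)
    [FiniteDimensional ℂ (translateSpan ψ)] : finrank ℂ (translateSpan ψ) ≤ n := by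
  by_contra! hlt
  obtain ⟨b, hbs, hspan, hli⟩ :=
    exists_linearIndependent ℂ (Set.range fun g : H => translation g ψ)
  have hspan' : Submodule.span ℂ b = translateSpan ψ := hspan
  have : FiniteDimensional ℂ (Submodule.span ℂ b) := hspan' ▸ inferInstance
  have hbfin : b.Finite := by
    have hli' : LinearIndependent ℂ fun x : b =>
        (⟨x, Submodule.subset_span x.2⟩ : Submodule.span ℂ b) :=
      LinearIndependent.of_comp (Submodule.span ℂ b).subtype hli
    exact Set.finite_coe_iff.1 hli'.finite
  have := hbfin.fintype
  have hcard : n ≤ Fintype.card b := by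
    have := finrank_span_set_eq_card (R := ℂ) (s := b) hli
    rw [hspan', Set.toFinset_card] at this
    lia
  let e : Fin n ↪ b := (Fin.castLEEmb hcard).trans (Fintype.equivFin b).symm.toEmbedding
  choose y hy using fun j => hbs (e j).2
  obtain ⟨c, hc⟩ := h y
  have hli2 := hli.comp e e.injective
  have hc0 : c.1 = 0 := funext fun j => Fintype.linearIndependent_iff.1 hli2 c.1 (by
    ext x
    simp only [Function.comp_apply, ← hy, Finset.sum_apply, Pi.smul_apply, smul_eq_mul,
      Pi.zero_apply]
    exact hc x) j
  have := c.2
  rw [mem_sphere_zero_iff_norm, hc0, norm_zero] at this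
  exact zero_ne_one this

lemma exists_translatesDependent (ψ : H → ℂ) [FiniteDimensional ℂ (translateSpan ψ)] :
    ∃ n, TranslatesDependent n ψ := by
  refine ⟨finrank ℂ (translateSpan ψ) + 1, fun y => ?_⟩
  let v : Fin (finrank ℂ (translateSpan ψ) + 1) → translateSpan ψ :=
    fun j => ⟨shift ℂ (y j) ψ, shift_mem_translateSpan ψ (y j)⟩
  have hv : ¬ LinearIndependent ℂ v := fun h => by
    have := h.fintype_card_le_finrank
    simp at this
  obtain ⟨g, hg, i, hi⟩ := Fintype.not_linearIndependent_iff.1 hv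
  have hg0 : ‖g‖ ≠ 0 := norm_ne_zero_iff.2 fun h => hi (by simp [h])
  refine ⟨⟨((‖g‖⁻¹ : ℝ) : ℂ) • g, ?_⟩, fun x => ?_⟩
  · simp [norm_smul, hg0]
  · have := congrFun (congrArg Subtype.val hg) x
    simp only [v, Submodule.coe_sum, Submodule.coe_smul, Finset.sum_apply, Pi.smul_apply,
      shift_apply, smul_eq_mul, ZeroMemClass.coe_zero, Pi.zero_apply] at this
    simp only [Pi.smul_apply, smul_eq_mul, mul_assoc, ← Finset.mul_sum, this, mul_zero]

/-- Normalized coefficients range over a compact sphere, and projection along a compact factor is a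
closed map. -/
lemma isClosed_setOf_translatesDependent {E : Type*} [NormedAddCommGroup E] [NormedSpace ℂ E]
    (f : H → E) (n : ℕ) :
    IsClosed {u : StrongDual ℂ E | TranslatesDependent n fun x => u (f x)} := by
  have : {u : StrongDual ℂ E | TranslatesDependent n fun x => u (f x)} =
      ⋂ y : Fin n → H, Prod.fst '' {uc : StrongDual ℂ E × Metric.sphere (0 : Fin n → ℂ) 1 |
        ∀ x, ∑ j, uc.2.1 j * uc.1 (f (x + y j)) = 0} := by
    ext u
    simp [TranslatesDependent]
  rw [this]
  have : CompactSpace (Metric.sphere (0 : Fin n → ℂ) 1) :=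
    isCompact_iff_compactSpace.1 (isCompact_sphere _ _)
  refine isClosed_iInter fun y => isClosedMap_fst_of_compactSpace _ ?_
  simp only [Set.ofPred_forall]
  refine isClosed_iInter fun x => isClosed_eq ?_ continuous_const
  refine continuous_finsetSum _ fun j _ => ?_
  exact ((continuous_apply j).comp (continuous_subtype_val.comp continuous_snd)).mul
    (((ContinuousLinearMap.apply ℂ ℂ (f (x + y j))).continuous).comp continuous_fst)

lemma translateSpan_comp_le_sup {E : Type*} [NormedAddCommGroup E] [NormedSpace ℂ E] (f : H → E)
    (u v : StrongDual ℂ E) {c : ℂ} (hc : c ≠ 0) :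
    translateSpan (fun x => u (f x)) ≤
      translateSpan (fun x => (v + c • u) (f x)) ⊔ translateSpan fun x => v (f x) := by
  refine translateSpan_le fun g => ?_
  have : shift ℂ g (fun x => u (f x)) =
      c⁻¹ • (shift ℂ g (fun x => (v + c • u) (f x)) - shift ℂ g fun x => v (f x)) := by
    ext x
    simp [hc]
  rw [this]
  exact Submodule.smul_mem _ _ (Submodule.sub_mem _
    (Submodule.mem_sup_left (shift_mem_translateSpan _ g))
    (Submodule.mem_sup_right (shift_mem_translateSpan _ g)))

lemma exists_finrank_translateSpan_comp_le {E : Type*} [NormedAddCommGroup E] [NormedSpace ℂ E]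
    (f : H → E) (hf : ∀ u : StrongDual ℂ E, FiniteDimensional ℂ (translateSpan fun x => u (f x))) :
    ∃ N, ∀ u : StrongDual ℂ E, finrank ℂ (translateSpan fun x => u (f x)) ≤ N := by
  obtain ⟨n, v, hv⟩ := nonempty_interior_of_iUnion_of_closed
    (isClosed_setOf_translatesDependent f)
    (Set.eq_univ_of_forall fun u => Set.mem_iUnion.2 (exists_translatesDependent fun x => u (f x)))
  -- With `v` interior, `v + c • u` stays in the set for small `c ≠ 0`; `u` is a combination of it
  -- and `v`, each contributing at most `n`.
  refine ⟨n + n, fun u => ?_⟩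
  obtain ⟨c, hc, hmem⟩ : ∃ c : ℂ, c ≠ 0 ∧
      v + c • u ∈ {u : StrongDual ℂ E | TranslatesDependent n fun x => u (f x)} := by
    have hcont : Filter.Tendsto (fun c : ℂ => v + c • u) (nhdsWithin 0 {0}ᶜ) (nhds v) := by
      have : Continuous fun c : ℂ => v + c • u := by fun_prop
      have h0 : v + (0 : ℂ) • u = v := by
        ext x
        simp
      have h1 := this.tendsto 0
      simp only [h0] at h1
      exact h1.mono_left nhdsWithin_le_nhds
    have h1 := hcont.eventually (mem_interior_iff_mem_nhds.1 hv)
    obtain ⟨c, hc1, hc2⟩ := (h1.and self_mem_nhdsWithin).exists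
    exact ⟨c, hc2, hc1⟩
  have h1 : finrank ℂ (translateSpan fun x => (v + c • u) (f x)) ≤ n :=
    TranslatesDependent.finrank_le hmem
  have h2 : finrank ℂ (translateSpan fun x => v (f x)) ≤ n :=
    TranslatesDependent.finrank_le (interior_subset hv)
  exact (Submodule.finrank_mono (translateSpan_comp_le_sup f u v hc)).trans
    ((Submodule.finrank_add_le_finrank_add_finrank _ _).trans (add_le_add h1 h2))

end Baire

/-! ### Groups of finite torsion free rank -/

section FiniteRank

variable {H : Type*} [AddCommGroup H]

lemma inf_jointGenEigenspace_ne_bot {φ χ : H → ℂ} [FiniteDimensional ℂ (translateSpan φ)]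
    (h : φ ∉ ⨆ (χ') (_ : χ' ≠ χ), jointGenEigenspace χ') :
    translateSpan φ ⊓ jointGenEigenspace χ ≠ ⊥ := by
  intro hbot
  refine h ?_
  have hmem := le_iSup_inf_jointGenEigenspace (translateSpan φ)
    (fun g v hv => shift_mapsTo_translateSpan φ g hv) (self_mem_translateSpan φ)
  refine (iSup_le fun χ' => ?_ :
    ⨆ χ', translateSpan φ ⊓ jointGenEigenspace χ' ≤ _) hmem
  by_cases hχ : χ' = χ
  · rw [hχ, hbot]
    exact bot_le
  · exact inf_le_right.trans (le_iSup₂_of_le χ' hχ le_rfl)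

lemma card_le_finrank_of_inf_jointGenEigenspace_ne_bot (V : Submodule ℂ (H → ℂ))
    [FiniteDimensional ℂ V] (T : Finset (H → ℂ))
    (hT : ∀ χ ∈ T, V ⊓ jointGenEigenspace χ ≠ ⊥) : T.card ≤ finrank ℂ V := by
  choose v hv hv0 using fun χ : T => (Submodule.ne_bot_iff _).1 (hT χ χ.2)
  have hli : LinearIndependent ℂ v :=
    (iSupIndep_jointGenEigenspace.comp Subtype.coe_injective).linearIndependent _
      (fun χ => (hv χ).2) hv0
  have hli' : LinearIndependent ℂ fun χ : T => (⟨v χ, (hv χ).1⟩ : V) :=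
    LinearIndependent.of_comp V.subtype hli
  simpa using hli'.fintype_card_le_finrank

variable {E : Type*} [NormedAddCommGroup E] [NormedSpace ℂ E]

/-- If all scalar components of `f` lie in a fixed translation invariant finite dimensional space,
then the translates of `f` span a finite dimensional space. -/
lemma finiteDimensional_translateSpan_of_forall_comp_mem (f : H → E) (W : Submodule ℂ (H → ℂ))
    [FiniteDimensional ℂ W] (hW : ∀ g, ∀ w ∈ W, shift ℂ g w ∈ W)
    (hf : ∀ u : StrongDual ℂ E, (fun x => u (f x)) ∈ W) : FiniteDimensional ℂ (translateSpan f) := by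
  obtain ⟨s, r, hr⟩ := exists_interpolation W
  let Θ : (s → W) →ₗ[ℂ] (H → E) :=
    { toFun := fun w x => ∑ y : s, (w y : H → ℂ) x • f y
      map_add' := fun w w' => by
        ext x
        simp [add_smul, Finset.sum_add_distrib]
      map_smul' := fun c w => by
        ext x
        simp [mul_smul, Finset.smul_sum] }
  have hfx : ∀ x, f x = ∑ y : s, (r y : H → ℂ) x • f y := fun x => by
    refine (SeparatingDual.eq_iff_forall_dual_eq (R := ℂ)).2 fun u => ?_
    have := congrFun (congrArg Subtype.val (hr ⟨_, hf u⟩)) x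
    simp only [Submodule.coe_sum, Submodule.coe_smul, Finset.sum_apply, Pi.smul_apply,
      smul_eq_mul] at this
    rw [this, map_sum]
    simp only [map_smul, smul_eq_mul, mul_comm]
  refine finiteDimensional_translateSpan_of_mem (LinearMap.range Θ) fun g => ?_
  refine ⟨fun y => ⟨shift ℂ g (r y), hW g _ (r y).2⟩, ?_⟩
  ext x
  exact (hfx (x + g)).symm

lemma finiteDimensional_translateSpan_of_rank_lt_aleph0 (hH : Module.rank ℤ H < Cardinal.aleph0)
    (f : H → E)
    (hf : ∀ u : StrongDual ℂ E, FiniteDimensional ℂ (translateSpan fun x => u (f x))) :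
    FiniteDimensional ℂ (translateSpan f) := by
  obtain ⟨N, hN⟩ := exists_finrank_translateSpan_comp_le f hf
  let Ψ : StrongDual ℂ E →ₗ[ℂ] (H → ℂ) :=
    { toFun := fun u x => u (f x)
      map_add' := fun _ _ => rfl
      map_smul' := fun _ _ => rfl }
  -- `K χ` collects the functionals `u` for which `u ∘ f` has no `χ`-component.
  let K : (H → ℂ) → Submodule ℂ (StrongDual ℂ E) := fun χ =>
    (⨆ (χ') (_ : χ' ≠ χ), jointGenEigenspace χ').comap Ψ
  have hK : ∀ u χ, u ∉ K χ → translateSpan (Ψ u) ⊓ jointGenEigenspace χ ≠ ⊥ := fun u χ hu =>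
    have := hf u
    inf_jointGenEigenspace_ne_bot hu
  have hfin : {χ | K χ ≠ ⊤}.Finite := by
    by_contra hinf
    obtain ⟨T, hT, hTcard⟩ := Set.Infinite.exists_subset_card_eq hinf (N + 1)
    -- A complex vector space is not a finite union of proper subspaces.
    obtain ⟨u, hu⟩ : ∃ u, ∀ χ ∈ T, u ∉ K χ := by
      by_contra! hcov
      obtain ⟨χ, hχ⟩ := Subspace.exists_eq_top_of_iUnion_eq_univ (p := fun χ : T => K χ)
        (Set.eq_univ_of_forall fun u => by
          obtain ⟨χ, hχ, h⟩ := hcov u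
          exact Set.mem_iUnion.2 ⟨⟨χ, hχ⟩, h⟩)
      exact hT χ.2 hχ
    have := hf u
    have h1 := card_le_finrank_of_inf_jointGenEigenspace_ne_bot (translateSpan (Ψ u)) T
      fun χ hχ => hK u χ (hu χ hχ)
    have h2 : finrank ℂ (translateSpan (Ψ u)) ≤ N := hN u
    lia
  have := hfin.to_subtype
  have hfd : ∀ χ : {χ | K χ ≠ ⊤}, FiniteDimensional ℂ (genEigenfunctions χ.1 N) := by
    rintro ⟨χ, hχ⟩
    obtain ⟨u, hu⟩ : ∃ u, u ∉ K χ := by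
      by_contra! h
      exact hχ (eq_top_iff.2 fun u _ => h u)
    have := hf u
    obtain ⟨-, h0, hm⟩ := mem_of_inf_jointGenEigenspace_ne_bot (translateSpan (Ψ u))
      (fun g v hv => shift_mapsTo_translateSpan _ g hv) (hK u χ hu)
    exact finiteDimensional_genEigenfunctions hH h0 hm N
  refine finiteDimensional_translateSpan_of_forall_comp_mem f
    (⨆ χ : {χ | K χ ≠ ⊤}, genEigenfunctions χ.1 N) (fun g => ?_) fun u => ?_
  · suffices (⨆ χ : {χ | K χ ≠ ⊤}, genEigenfunctions χ.1 N) ≤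
        (⨆ χ : {χ | K χ ≠ ⊤}, genEigenfunctions χ.1 N).comap (shift ℂ g) from fun w hw => this hw
    exact iSup_le fun χ w hw =>
      Submodule.mem_iSup_of_mem χ (shift_mem_genEigenfunctions hw g)
  · have := hf u
    have hinv : ∀ g, ∀ v ∈ translateSpan (Ψ u), shift ℂ g v ∈ translateSpan (Ψ u) :=
      fun g v hv => shift_mapsTo_translateSpan _ g hv
    change Ψ u ∈ _
    obtain ⟨a, ha, hsum⟩ := (Submodule.mem_iSup_iff_exists_finsupp _ _).1
      (le_iSup_inf_jointGenEigenspace (translateSpan (Ψ u)) hinv (self_mem_translateSpan (Ψ u)))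
    rw [← hsum]
    refine Submodule.sum_mem _ fun χ hχ => ?_
    -- For `χ` outside the finite list, the `χ`-component also lies in the sum of the other
    -- eigenspaces, so independence makes it zero.
    by_cases htop : K χ = ⊤
    · have hu : Ψ u ∈ ⨆ (χ') (_ : χ' ≠ χ), jointGenEigenspace χ' := by
        change u ∈ K χ
        exact htop ▸ Submodule.mem_top
      have hrest : a χ ∈ ⨆ (χ') (_ : χ' ≠ χ), jointGenEigenspace χ' := by
        classical
        have h1 : a χ = Ψ u - ∑ χ' ∈ a.support.erase χ, a χ' := by
          rw [← hsum, Finsupp.sum, ← Finset.add_sum_erase _ _ hχ, add_sub_cancel_right]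
        rw [h1]
        refine Submodule.sub_mem _ hu (Submodule.sum_mem _ fun χ' hχ' => ?_)
        exact Submodule.mem_iSup_of_mem χ'
          (Submodule.mem_iSup_of_mem (Finset.ne_of_mem_erase hχ') (ha χ').2)
      have h0 : a χ = 0 :=
        Submodule.disjoint_def.1 (iSupIndep_jointGenEigenspace χ) _ (ha χ).2 hrest
      rw [h0]
      exact Submodule.zero_mem _
    · exact Submodule.mem_iSup_of_mem (⟨χ, htop⟩ : {χ | K χ ≠ ⊤}) (mem_genEigenfunctions.2 fun g =>
        pow_apply_eq_zero_of_mem_inf_jointGenEigenspace _ hinv (ha χ) (hN u) g)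

end FiniteRank

/-! ### Passage from a dense subgroup -/

section Dense

variable {E : Type*} [NormedAddCommGroup E] [NormedSpace ℂ E]

/-- The span over `H` is finite dimensional, hence closed for pointwise convergence, so it contains
the restrictions of translates by all `g` in `G`. Restriction to `H` is injective on continuous
functions. -/
lemma finiteDimensional_translateSpan_of_dense {G : Type*} [AddCommGroup G] [TopologicalSpace G]
    [IsTopologicalAddGroup G] (H : AddSubgroup G) (hH : Dense (H : Set G)) {f : G → E}
    (hf : Continuous f) (hfd : FiniteDimensional ℂ (translateSpan fun x : H => f x)) :
    FiniteDimensional ℂ (translateSpan f) := by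
  let ρ : (G → E) →ₗ[ℂ] (H → E) := LinearMap.funLeft ℂ E ((↑) : H → G)
  have hclosed : IsClosed (translateSpan (fun x : H => f x) : Set (H → E)) :=
    Submodule.closed_of_finiteDimensional _
  have hmem : ∀ g, ρ (shift E g f) ∈ translateSpan fun x : H => f x := by
    have hcont : Continuous fun g => ρ (shift E g f) :=
      continuous_pi fun x => hf.comp (continuous_const_add (x : G))
    intro g
    have hsub : (H : Set G) ⊆ (fun g => ρ (shift E g f)) ⁻¹'
        (translateSpan (fun x : H => f x) : Set (H → E)) := fun h hh =>
      shift_mem_translateSpan (fun x : H => f x) ⟨h, hh⟩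
    exact (hclosed.preimage hcont).closure_subset_iff.2 hsub (hH g)
  have hcomap : translateSpan f ≤ (translateSpan fun x : H => f x).comap ρ :=
    translateSpan_le hmem
  have hcont : ∀ w ∈ translateSpan f, Continuous w := by
    intro w hw
    induction hw using Submodule.span_induction with
    | mem w hw =>
      obtain ⟨g, rfl⟩ := hw
      exact hf.comp (continuous_add_const g)
    | zero => exact continuous_const
    | add v w _ _ hv hw => exact hv.add hw
    | smul c w _ hw => exact hw.const_smul c
  refine FiniteDimensional.of_injective (ρ.restrict (q := translateSpan fun x : H => f x) hcomap) ?_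
  refine LinearMap.ker_eq_bot.1 (LinearMap.ker_eq_bot'.2 fun w hw => Subtype.ext ?_)
  refine (hcont w w.2).ext_on hH continuous_const fun x hx => ?_
  exact congrFun (congrArg Subtype.val hw) ⟨x, hx⟩

lemma isWExpPolynomial_iff_isExpPolynomial {G : Type*} [AddCommGroup G] [TopologicalSpace G]
    [IsTopologicalAddGroup G] (H : AddSubgroup G) (hH : Dense (H : Set G))
    (hrank : torsionFreeRank H < Cardinal.aleph0) (f : G → E) :
    IsWExpPolynomial f ↔ IsExpPolynomial f := by
  refine ⟨fun ⟨hf, h⟩ => ⟨hf, ?_⟩, fun ⟨hf, h⟩ => ⟨hf, fun u => ?_⟩⟩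
  · refine finiteDimensional_translateSpan_of_dense H hH hf
      (finiteDimensional_translateSpan_of_rank_lt_aleph0 hrank _ fun u => ?_)
    have := (h u).finiteDimensional_translateSpan
    exact finiteDimensional_translateSpan_comp_addMonoidHom H.subtype (f := fun x => u (f x))
  · have := finiteDimensional_translateSpan_comp_linearMap (u : E →ₗ[ℂ] ℂ) (f := f)
    exact isComplexExpPolynomial_of_finiteDimensional (u.continuous.comp hf)

end Dense

/-- The rational points serve: the `ℤ`-rank of `ℚ ^ p` equals its `ℚ`-rank by localization. -/
lemma exists_dense_addSubgroup_rank_lt_aleph0 (p : ℕ) :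
    ∃ H : AddSubgroup (EuclideanSpace ℝ (Fin p)), Dense (H : Set (EuclideanSpace ℝ (Fin p))) ∧
      torsionFreeRank H < Cardinal.aleph0 := by
  let j : (Fin p → ℚ) →+ EuclideanSpace ℝ (Fin p) :=
    { toFun := fun q => WithLp.toLp 2 fun i => (q i : ℝ)
      map_zero' := by ext; simp
      map_add' := fun _ _ => by ext; simp }
  refine ⟨j.range, ?_, ?_⟩
  · have h1 : DenseRange fun (q : Fin p → ℚ) (i : Fin p) => (q i : ℝ) :=
      DenseRange.piMap fun _ => Rat.isDenseEmbedding_coe_real.dense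
    have h2 : DenseRange (WithLp.toLp 2 : (Fin p → ℝ) → EuclideanSpace ℝ (Fin p)) :=
      (WithLp.toLp_surjective 2).denseRange
    exact h2.comp h1 (PiLp.continuous_toLp 2 _)
  · have hle : Module.rank ℤ j.range ≤ Module.rank ℤ (Fin p → ℚ) := by
      have := LinearMap.lift_rank_le_of_surjective j.toIntLinearMap.rangeRestrict
        j.toIntLinearMap.surjective_rangeRestrict
      simp only [Cardinal.lift_id] at this
      exact this
    have hrank : Module.rank ℤ (Fin p → ℚ) = Module.rank ℚ (Fin p → ℚ) :=
      (IsLocalization.rank_eq ℚ (nonZeroDivisors ℤ) le_rfl).symm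
    refine lt_of_le_of_lt hle ?_
    rw [hrank]
    exact Module.rank_lt_aleph0 ℚ _

end VectorPoly

theorem mainTheorem10 {E : Type*} [NormedAddCommGroup E] [NormedSpace ℂ E] [CompleteSpace E] :
    (∀ (G : Type*) [AddCommGroup G] [TopologicalSpace G] [IsTopologicalAddGroup G]
        (H : AddSubgroup G), Dense (H : Set G) →
        VectorPoly.torsionFreeRank H < Cardinal.aleph0 →
        ∀ f : G → E, VectorPoly.IsWExpPolynomial f ↔ VectorPoly.IsExpPolynomial f) ∧
    (∀ (p : ℕ) (f : EuclideanSpace ℝ (Fin p) → E),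
        VectorPoly.IsWExpPolynomial f ↔ VectorPoly.IsExpPolynomial f) := by
  refine ⟨fun G _ _ _ H hH hrank f =>
    VectorPoly.isWExpPolynomial_iff_isExpPolynomial H hH hrank f, fun p f => ?_⟩
  obtain ⟨H, hH, hrank⟩ := VectorPoly.exists_dense_addSubgroup_rank_lt_aleph0 p
  exact VectorPoly.isWExpPolynomial_iff_isExpPolynomial H hH hrank f
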